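/- Let $(\Omega,\mathcal F,P)$ be a probability space and $\{\mathcal F_n\}_{n\ge0}$ a nondecreasing sequence of sub-$\sigma$-algebras of $\mathcal F$ with $\mathcal F_0=\{\emptyset,\Omega\}$ and $\mathcal F=\sigma(\bigcup_n\mathcal F_n)$. A set $B\in\mathcal F_n$ is called an atom of $\mathcal F_n$ if every $A\subset B$ with $A\in\mathcal F_n$ satisfies $P(A)=P(B)$ or $P(A)=0$; suppose that every $\mathcal F_n$ is generated by countably many atoms, and let $A(\mathcal F_n)$ denote the set of atoms of $\mathcal F_n$ of positive probability. Suppose that $\{\mathcal F_n\}$ is regular, that is, for some $R\ge2$ every non-negative martingale $(f_n)_{n\ge0}$ satisfies $f_n\le Rf_{n-1}$ almost surely for all $n\ge1$. Let $\alpha>0$. Functions are real-valued throughout, or complex-valued throughout. Write $E$ for the expectation and $E_n$ for the conditional expectation relative to $\mathcal F_n$. For $f\in L_1$ let $$\|f\|_{\mathrm{Lip}_\alpha}=\sup_{n\ge0}\ \sup_{B\in A(\mathcal F_n)}\frac1{P(B)^\alpha}\,\frac1{P(B)}\int_B|f-E_nf|\,dP,\qquad \|f\|_{\mathrm{Lip}^\natural_\alpha}=\|f\|_{\mathrm{Lip}_\alpha}+|Ef|,$$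 and let $\mathrm{Lip}_\alpha$ and $\mathrm{Lip}^\natural_\alpha$ be the sets of those $f\in L_1$ for which $\|f\|_{\mathrm{Lip}_\alpha}<\infty$ and $\|f\|_{\mathrm{Lip}^\natural_\alpha}<\infty$, respectively. Let $\mathrm{PWM}(\mathrm{Lip}^\natural_\alpha)$ be the set of all $\mathcal F$-measurable functions $g$ such that $fg\in\mathrm{Lip}^\natural_\alpha$ for every $f\in\mathrm{Lip}^\natural_\alpha$, and for such $g$ let $$\|g\|_{Op}=\sup\left\{\frac{\|fg\|_{\mathrm{Lip}^\natural_\alpha}}{\|f\|_{\mathrm{Lip}^\natural_\alpha}} : f\in\mathrm{Lip}^\natural_\alpha,\ f \text{ not almost surely } 0\right\}.$$ Then $$\mathrm{PWM}(\mathrm{Lip}^\natural_\alpha)=\mathrm{Lip}_\alpha\cap L_\infty .$$ Moreover, there is a constant $C>0$, depending only on $\alpha$ and $R$, such that for every $g\in\mathrm{PWM}(\mathrm{Lip}^\natural_\alpha)$ $$C^{-1}\|g\|_{Op}\le\|g\|_{\mathrm{Lip}_\alpha}+\|g\|_{L_\infty}\le C\,\|g\|_{Op}.$$ -/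

import Mathlib

open MeasureTheory
open scoped ENNReal NNReal

namespace MartingaleCampanato

/-- `B` is an atom of the σ-algebra `𝓐` with respect to `P`: `B ∈ 𝓐`, and every `A ⊆ B` with
`A ∈ 𝓐` satisfies `P A = P B` or `P A = 0`. (Null sets are atoms in this sense; they are left out
wherever one divides by `P B`.) -/
def IsAtom {Ω : Type*} {m : MeasurableSpace Ω} (P : Measure Ω) (𝓐 : MeasurableSpace Ω)
    (B : Set Ω) : Prop :=
  MeasurableSet[𝓐] B ∧ ∀ A ⊆ B, MeasurableSet[𝓐] A → P A = P B ∨ P A = 0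

/-- The σ-algebra `𝓐` is generated by countably many atoms. -/
def CountablyAtomic {Ω : Type*} {m : MeasurableSpace Ω} (P : Measure Ω)
    (𝓐 : MeasurableSpace Ω) : Prop :=
  ∃ S : Set (Set Ω), S.Countable ∧ (∀ B ∈ S, IsAtom P 𝓐 B) ∧ 𝓐 = MeasurableSpace.generateFrom S

/-- The filtration is regular with constant `R`: `f_n ≤ R f_{n-1}` almost surely, `n ≥ 1`, for all
non-negative martingales. -/
def IsRegularWith {Ω : Type*} {m : MeasurableSpace Ω} (ℱ : Filtration ℕ m) (P : Measure Ω)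
    (R : ℝ) : Prop :=
  ∀ f : ℕ → Ω → ℝ, Martingale f ℱ P → (∀ n, 0 ≤ᵐ[P] f n) →
    ∀ n, ∀ᵐ ω ∂P, f (n + 1) ω ≤ R * f n ω

section Spaces

variable {Ω : Type*} {m : MeasurableSpace Ω} {𝕜 : Type*} [RCLike 𝕜]

/-- The space `L₁` of integrable measurable functions. -/
def L1 (𝕜 : Type*) [RCLike 𝕜] (P : Measure Ω) : Set (Ω → 𝕜) :=
  {f | Measurable f ∧ Integrable f P}

/-- The space `L_∞` of essentially bounded measurable functions. -/
def Linfty (𝕜 : Type*) [RCLike 𝕜] (P : Measure Ω) : Set (Ω → 𝕜) :=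
  {f | Measurable f ∧ MemLp f ∞ P}

/-- The Campanato seminorm
`sup_n sup_B φ(P B)⁻¹ (P(B)⁻¹ ∫_B |f - E_n f|^p dP)^(1/p)`, where `B` runs over the atoms of
`ℱ n` of positive probability; only the values of `φ` on `(0, 1]` matter. -/
noncomputable def campanatoSeminorm (ℱ : Filtration ℕ m) (P : Measure Ω) (p : ℝ) (φ : ℝ → ℝ)
    (f : Ω → 𝕜) : ℝ≥0∞ :=
  ⨆ (n : ℕ) (B : Set Ω) (_ : IsAtom P (ℱ n) B) (_ : P B ≠ 0),
    (⨍⁻ ω in B, ‖f ω - (P[f | ℱ n]) ω‖ₑ ^ p ∂P) ^ (1 / p) / ENNReal.ofReal (φ (P.real B))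

/-- The Campanato norm: the Campanato seminorm plus `|E f|`. -/
noncomputable def campanatoNorm (ℱ : Filtration ℕ m) (P : Measure Ω) (p : ℝ) (φ : ℝ → ℝ)
    (f : Ω → 𝕜) : ℝ≥0∞ :=
  campanatoSeminorm ℱ P p φ f + ‖∫ ω, f ω ∂P‖ₑ

/-- The seminorm of `Lip_α`, that is `p = 1`, `φ(r) = r ^ α`. -/
noncomputable def lipSeminorm (ℱ : Filtration ℕ m) (P : Measure Ω) (α : ℝ) (f : Ω → 𝕜) : ℝ≥0∞ :=
  campanatoSeminorm ℱ P 1 (fun r => r ^ α) f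

/-- The norm of `Lip♮_α`, that is `p = 1`, `φ(r) = r ^ α`. -/
noncomputable def lipNorm (ℱ : Filtration ℕ m) (P : Measure Ω) (α : ℝ) (f : Ω → 𝕜) : ℝ≥0∞ :=
  campanatoNorm ℱ P 1 (fun r => r ^ α) f

/-- The space `Lip_α` of the `f ∈ L₁` with finite `Lip_α`-seminorm. -/
def Lip (𝕜 : Type*) [RCLike 𝕜] (ℱ : Filtration ℕ m) (P : Measure Ω) (α : ℝ) : Set (Ω → 𝕜) :=
  {f | f ∈ L1 𝕜 P ∧ lipSeminorm ℱ P α f < ∞}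

/-- The space `Lip♮_α` of the `f ∈ L₁` with finite `Lip♮_α`-norm. -/
def LipNat (𝕜 : Type*) [RCLike 𝕜] (ℱ : Filtration ℕ m) (P : Measure Ω) (α : ℝ) : Set (Ω → 𝕜) :=
  {f | f ∈ L1 𝕜 P ∧ lipNorm ℱ P α f < ∞}

/-- The set of pointwise multipliers on a space `X` of measurable functions. -/
def PWM {Ω : Type*} [MeasurableSpace Ω] (X : Set (Ω → 𝕜)) : Set (Ω → 𝕜) :=
  {g | Measurable g ∧ ∀ f ∈ X, f * g ∈ X}

/-- The operator norm of the multiplication by `g` on the space `X` with norm `N`: the supremum of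
`N (f g) / N f` over the `f ∈ X` that are not almost surely zero. -/
noncomputable def opNorm (P : Measure Ω) (X : Set (Ω → 𝕜)) (N : (Ω → 𝕜) → ℝ≥0∞) (g : Ω → 𝕜) :
    ℝ≥0∞ :=
  ⨆ (f : Ω → 𝕜) (_ : f ∈ X) (_ : ¬ f =ᵐ[P] 0), N (f * g) / N f

end Spaces

end MartingaleCampanato

/-! For `α > 0` a function in `Lip_α` is automatically bounded, so the space behaves like an
algebra. Regularity makes a non-negligible `A ∈ ℱ (n + 1)` inside an atom `B` of `ℱ n` either fill
`B` up to a null set or shrink it by a factor at most `1 - 1/R`. The averages of `f` over `A` and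
`B` then differ by at most a constant times `P(B)^α - P(A)^α` (`IsRegularWith.norm_average_sub_le`).
These differences telescope along nested atoms, and martingale convergence turns the uniform bound
on averages into `‖f‖_∞ ≤ K ‖f‖` in the norm of `Lip♮_α` (`IsRegularWith.eLpNorm_top_le`).

A Leibniz-type estimate for oscillations (`lipSeminorm_mul_le`) then makes every `g ∈ Lip_α ∩ L_∞` a
multiplier. Conversely, testing a multiplier on the constant `1` puts `g` itself in `Lip♮_α`, hence
in `L_∞`. -/

namespace MartingaleCampanato

open Filter

/-! ### Atoms and conditional expectations on them -/

section Atoms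

variable {Ω : Type*} {m : MeasurableSpace Ω} {P : Measure Ω} {𝓐 : MeasurableSpace Ω}

/-- A σ-algebra generated by countably many atoms is covered by countably many atoms. -/
theorem CountablyAtomic.exists_cover (h : CountablyAtomic P 𝓐) :
    ∃ T : Set (Set Ω), T.Countable ∧ (∀ B ∈ T, IsAtom P 𝓐 B) ∧ ⋃₀ T = Set.univ := by
  obtain ⟨S, hSc, hS, rfl⟩ := h
  -- The generated σ-algebra cannot split the part of `Ω` missed by the generators, so that part is
  -- one more atom and completes the cover.
  have key : ∀ A, MeasurableSet[MeasurableSpace.generateFrom S] A →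
      (⋃₀ S)ᶜ ⊆ A ∨ Disjoint (⋃₀ S)ᶜ A := by
    intro A hA
    induction A, hA using MeasurableSpace.generateFrom_induction with
    | hC t ht _ =>
      right
      rw [Set.disjoint_compl_left_iff_subset]
      exact Set.subset_sUnion_of_mem ht
    | empty => right; simp
    | compl t _ ih =>
      rcases ih with ih | ih
      · right; exact Set.disjoint_compl_right_iff_subset.mpr ih
      · left; exact Set.subset_compl_iff_disjoint_right.mpr ih
    | iUnion s _ ih =>
      by_cases hs : ∃ n, (⋃₀ S)ᶜ ⊆ s n
      · obtain ⟨n, hn⟩ := hs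
        exact Or.inl (hn.trans (Set.subset_iUnion s n))
      · push Not at hs
        exact Or.inr (Set.disjoint_iUnion_right.mpr fun n => (ih n).resolve_left (hs n))
  refine ⟨insert (⋃₀ S)ᶜ S, hSc.insert _, ?_, by simp⟩
  rintro B (rfl | hB)
  · refine ⟨(MeasurableSet.sUnion hSc fun B hB => (hS B hB).1).compl, fun A hA hAm => ?_⟩
    rcases key A hAm with h | h
    · exact Or.inl (by rw [hA.antisymm h])
    · exact Or.inr (by rw [h.eq_bot_of_ge hA]; simp)
  · exact hS B hB

theorem CountablyAtomic.ae_of_forall_atom (h : CountablyAtomic P 𝓐) {p : Ω → Prop}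
    (hp : ∀ B, IsAtom P 𝓐 B → P B ≠ 0 → ∀ᵐ ω ∂P.restrict B, p ω) : ∀ᵐ ω ∂P, p ω := by
  obtain ⟨T, hTc, hT, hTu⟩ := h.exists_cover
  rw [← Measure.restrict_univ (μ := P), ← hTu, Set.sUnion_eq_biUnion,
    ae_restrict_biUnion_iff _ hTc]
  intro B hB
  by_cases h0 : P B = 0
  · simp [Measure.restrict_eq_zero.mpr h0]
  · exact hp B (hT B hB) h0

theorem CountablyAtomic.exists_atom_inter_ne_zero (h : CountablyAtomic P 𝓐) {B : Set Ω}
    (hB : P B ≠ 0) : ∃ A, IsAtom P 𝓐 A ∧ P (A ∩ B) ≠ 0 := by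
  obtain ⟨T, hTc, hT, hTu⟩ := h.exists_cover
  by_contra! hcon
  apply hB
  rw [← Set.univ_inter B, ← hTu, Set.sUnion_eq_biUnion, Set.iUnion₂_inter,
    measure_biUnion_null_iff hTc]
  exact fun A hA => hcon A (hT A hA)

/-- A function measurable with respect to `𝓐` is almost surely constant on each atom of `𝓐`. -/
theorem IsAtom.exists_ae_eq_const [IsFiniteMeasure P] (h𝓐 : 𝓐 ≤ m) {E : Type*}
    [TopologicalSpace E] [SecondCountableTopology E] [T0Space E] [MeasurableSpace E]
    [OpensMeasurableSpace E] [Nonempty E] {B : Set Ω} (hB : IsAtom P 𝓐 B) {h : Ω → E}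
    (hh : Measurable[𝓐] h) : ∃ c : E, ∀ᵐ ω ∂P.restrict B, h ω = c := by
  refine exists_eventuallyEq_const_of_forall_separating MeasurableSet fun U hU => ?_
  have hm : MeasurableSet[𝓐] (B ∩ h ⁻¹' U) := hB.1.inter (hh hU)
  rcases hB.2 _ Set.inter_subset_left hm with h1 | h1
  · left
    rw [ae_restrict_iff' (h𝓐 _ hB.1)]
    have := ae_le_set.mp (ae_eq_of_subset_of_measure_ge Set.inter_subset_left h1.ge
      (h𝓐 _ hm).nullMeasurableSet (measure_ne_top _ _)).symm.le
    rw [ae_iff]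
    convert this using 2
    ext ω; simp
  · right
    rw [ae_restrict_iff' (h𝓐 _ hB.1), ae_iff]
    convert h1 using 2
    ext ω; simp

variable {E : Type*} [NormedAddCommGroup E] [NormedSpace ℝ E] [CompleteSpace E]

/-- On an atom of positive probability, the conditional expectation is the average. -/
theorem IsAtom.condExp_ae_eq_average [IsFiniteMeasure P] [SecondCountableTopology E]
    (h𝓐 : 𝓐 ≤ m) {B : Set Ω} (hB : IsAtom P 𝓐 B) (hB0 : P B ≠ 0) {f : Ω → E}
    (hf : Integrable f P) : ∀ᵐ ω ∂P.restrict B, (P[f | 𝓐]) ω = ⨍ x in B, f x ∂P := by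
  borelize E
  obtain ⟨c, hc⟩ := hB.exists_ae_eq_const h𝓐
    (stronglyMeasurable_condExp (μ := P) (m := 𝓐) (f := f)).measurable
  have h1 : ∫ ω in B, (P[f | 𝓐]) ω ∂P = P.real B • c := by
    rw [integral_congr_ae hc, setIntegral_const]
  rw [setIntegral_condExp h𝓐 hf hB.1] at h1
  have hpos : P.real B ≠ 0 := (ENNReal.toReal_pos hB0 (measure_ne_top _ _)).ne'
  filter_upwards [hc] with ω hω
  rw [hω, setAverage_eq, h1, inv_smul_smul₀ hpos]

end Atoms

/-! ### Regularity as a lower bound on the size of children -/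

section Regular

variable {Ω : Type*} {m : MeasurableSpace Ω} {P : Measure Ω} [IsProbabilityMeasure P]
  {ℱ : Filtration ℕ m} {R : ℝ}

/-- In a regular filtration, the sets of positive probability of `ℱ (n + 1)` inside an atom of
`ℱ n` have at least `R⁻¹` times the probability of the atom. -/
theorem IsRegularWith.measureReal_le (h : IsRegularWith ℱ P R) {n : ℕ} {A B : Set Ω}
    (hB : IsAtom P (ℱ n) B) (hA : MeasurableSet[ℱ (n + 1)] A) (hAB : A ⊆ B) (hA0 : P A ≠ 0) :
    P.real B ≤ R * P.real A := by
  have hAm : MeasurableSet A := ℱ.le _ _ hA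
  have hB0 : P B ≠ 0 := fun h0 => hA0 (measure_mono_null hAB h0)
  set f : Ω → ℝ := A.indicator 1 with hf
  have hfi : Integrable f P := (integrable_const (1 : ℝ)).indicator hAm
  have h1 := h _ (martingale_condExp f ℱ P)
    (fun k => condExp_nonneg (ae_of_all _ (Set.indicator_nonneg fun _ _ => zero_le_one))) n
  have h2 : P[f | ℱ (n + 1)] = f :=
    condExp_of_stronglyMeasurable (ℱ.le _) (stronglyMeasurable_one.indicator hA) hfi
  -- On `A` the martingale generated by the indicator of `A` equals `P(A)/P(B)` at time `n` and `1`
  -- at time `n + 1`; regularity compares the two.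
  have h3 := ae_restrict_of_ae_restrict_of_subset hAB (hB.condExp_ae_eq_average (ℱ.le n) hB0 hfi)
  have h4 : ∀ᵐ ω ∂P.restrict A, (1 : ℝ) ≤ R * (P.real B)⁻¹ * P.real A := by
    filter_upwards [ae_restrict_of_ae h1, h3, ae_restrict_mem hAm] with ω h1 h3 hω
    rw [h2, h3, setAverage_eq, hf, Set.indicator_of_mem hω, integral_indicator_one hAm,
      measureReal_restrict_apply hAm, Set.inter_eq_left.mpr hAB] at h1
    simpa [mul_assoc] using h1
  have : NeZero (P.restrict A) := ⟨by simpa using hA0⟩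
  obtain ⟨_, h5⟩ := h4.exists
  have hpos : 0 < P.real B := ENNReal.toReal_pos hB0 (measure_ne_top _ _)
  field_simp at h5
  exact h5

end Regular

/-! ### Boundedness from mean oscillation -/

section Bounded

variable {Ω : Type*} {m : MeasurableSpace Ω} {P : Measure Ω} [IsProbabilityMeasure P]
  {ℱ : Filtration ℕ m} {R α L : ℝ} {E : Type*} [NormedAddCommGroup E] [NormedSpace ℝ E]
  [CompleteSpace E] {f : Ω → E}

/-- The constant in the estimate of the averages by the mean oscillations. -/
noncomputable def chainConst (R α : ℝ) : ℝ := R / (1 - (1 - R⁻¹) ^ α)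

theorem one_sub_rpow_pos (hR : 2 ≤ R) (hα : 0 < α) : 0 < 1 - (1 - R⁻¹) ^ α := by
  have h1 : 0 < R⁻¹ := by positivity
  have h2 : R⁻¹ ≤ 1 := inv_le_one_of_one_le₀ (by linarith)
  linarith [Real.rpow_lt_one (z := α) (by linarith : 0 ≤ 1 - R⁻¹) (by linarith) hα]

theorem chainConst_pos (hR : 2 ≤ R) (hα : 0 < α) : 0 < chainConst R α :=
  div_pos (by linarith) (one_sub_rpow_pos hR hα)

theorem setAverage_sub_const {A : Set Ω} (hA0 : P A ≠ 0) (hf : Integrable f P) (c : E) :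
    ⨍ x in A, f x ∂P - c = (P.real A)⁻¹ • ∫ x in A, (f x - c) ∂P := by
  have hA : P.real A ≠ 0 := (ENNReal.toReal_pos hA0 (measure_ne_top _ _)).ne'
  rw [integral_sub hf.integrableOn (integrable_const c), setIntegral_const, smul_sub,
    inv_smul_smul₀ hA, setAverage_eq]

theorem norm_setAverage_sub_le {A : Set Ω} (hA0 : P A ≠ 0) (hf : Integrable f P) (c : E) :
    ‖⨍ x in A, f x ∂P - c‖ ≤ (P.real A)⁻¹ * ∫ x in A, ‖f x - c‖ ∂P := by
  rw [setAverage_sub_const hA0 hf, norm_smul, Real.norm_of_nonneg (by positivity)]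
  gcongr
  exact norm_integral_le_integral_norm _

/-- Writing the bound as a difference of powers is what lets it telescope. A bare bound by `R * L *
P(B)^α` would also be charged at every generation in which the atom does not shrink. -/
theorem IsRegularWith.norm_average_sub_le (h : IsRegularWith ℱ P R) (hR : 2 ≤ R) (hα : 0 < α)
    (hf : Integrable f P) {n : ℕ} {A B : Set Ω} (hB : IsAtom P (ℱ n) B)
    (hL : ∫ ω in B, ‖f ω - ⨍ x in B, f x ∂P‖ ∂P ≤ L * P.real B ^ α * P.real B) (hL0 : 0 ≤ L)
    (hA : MeasurableSet[ℱ (n + 1)] A) (hAB : A ⊆ B) (hA0 : P A ≠ 0) :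
    ‖⨍ x in A, f x ∂P - ⨍ x in B, f x ∂P‖ ≤
      chainConst R α * L * (P.real B ^ α - P.real A ^ α) := by
  have hAm : MeasurableSet A := ℱ.le _ _ hA
  have hBA : MeasurableSet[ℱ (n + 1)] (B \ A) := (ℱ.mono n.le_succ _ hB.1).diff hA
  have hApos : 0 < P.real A := ENNReal.toReal_pos hA0 (measure_ne_top _ _)
  have hR0 : 0 < R := by linarith
  -- If `A` fills `B`, both sides vanish; otherwise regularity also applies to `B \ A`, which forces
  -- `A` to be smaller by the factor `1 - R⁻¹`.
  by_cases hd : P (B \ A) = 0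
  · have hae : A =ᵐ[P] B := hAB.eventuallyLE.antisymm (ae_le_set.mpr hd)
    rw [setAverage_congr hae, measureReal_congr hae]
    simp
  have h1 := h.measureReal_le hB hA hAB hA0
  have h2 := h.measureReal_le hB hBA Set.sdiff_subset hd
  rw [measureReal_sdiff hAB hAm] at h2
  have hBpos : 0 < P.real B := hApos.trans_le (measureReal_mono hAB)
  have hinv : R * R⁻¹ = 1 := mul_inv_cancel₀ hR0.ne'
  have h3 : P.real A ≤ (1 - R⁻¹) * P.real B := by
    rw [← mul_le_mul_iff_right₀ hR0]
    linear_combination h2 + P.real B * hinv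
  have hθ : 0 ≤ 1 - R⁻¹ := by
    have : R⁻¹ ≤ 1 := inv_le_one_of_one_le₀ (by linarith)
    linarith
  have h4 : P.real A ^ α ≤ (1 - R⁻¹) ^ α * P.real B ^ α := by
    rw [← Real.mul_rpow hθ hBpos.le]
    exact Real.rpow_le_rpow hApos.le h3 hα.le
  have hpos := one_sub_rpow_pos hR hα
  have hmulK : chainConst R α * (1 - (1 - R⁻¹) ^ α) = R := div_mul_cancel₀ _ hpos.ne'
  calc ‖⨍ x in A, f x ∂P - ⨍ x in B, f x ∂P‖
      ≤ (P.real A)⁻¹ * ∫ x in A, ‖f x - ⨍ x in B, f x ∂P‖ ∂P := norm_setAverage_sub_le hA0 hf _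
    _ ≤ (P.real A)⁻¹ * ∫ x in B, ‖f x - ⨍ x in B, f x ∂P‖ ∂P := by
        gcongr ?_ * ?_
        refine setIntegral_mono_set ?_ (ae_of_all _ fun _ => norm_nonneg _) hAB.eventuallyLE
        exact (hf.sub (integrable_const _)).norm.integrableOn
    _ ≤ (P.real A)⁻¹ * (L * P.real B ^ α * (R * P.real A)) := by
        gcongr ?_ * ?_
        exact hL.trans (by gcongr)
    _ = R * L * P.real B ^ α := by field_simp
    _ = chainConst R α * L * (P.real B ^ α - (1 - R⁻¹) ^ α * P.real B ^ α) := by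
        linear_combination -L * P.real B ^ α * hmulK
    _ ≤ chainConst R α * L * (P.real B ^ α - P.real A ^ α) := by
        have := chainConst_pos hR hα
        gcongr

/-- The one-generation bounds telescope down from `Ω`, where the average is the expectation and
`P(Ω)^α = 1`. -/
theorem IsRegularWith.norm_average_le (h : IsRegularWith ℱ P R) (hR : 2 ≤ R) (hα : 0 < α)
    (h0 : ℱ 0 = ⊥) (hat : ∀ n, CountablyAtomic P (ℱ n)) (hf : Integrable f P) (hL0 : 0 ≤ L)
    (hL : ∀ n B, IsAtom P (ℱ n) B → P B ≠ 0 →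
      ∫ ω in B, ‖f ω - ⨍ x in B, f x ∂P‖ ∂P ≤ L * P.real B ^ α * P.real B)
    (n : ℕ) {B : Set Ω} (hB : IsAtom P (ℱ n) B) (hB0 : P B ≠ 0) :
    ‖⨍ x in B, f x ∂P‖ ≤ ‖∫ x, f x ∂P‖ + chainConst R α * L * (1 - P.real B ^ α) := by
  induction n generalizing B with
  | zero =>
    have hm := hB.1
    rw [h0, MeasurableSpace.measurableSet_bot_iff] at hm
    rcases hm with rfl | rfl
    · simp at hB0
    · simp [average_eq_integral]
  | succ n ih =>
    -- `B` need not lie inside an atom of `ℱ n`, but it does up to a null set: any `D` meeting it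
    -- with positive probability contains almost all of it.
    obtain ⟨D, hD, hDB⟩ := (hat n).exists_atom_inter_ne_zero hB0
    have hm : MeasurableSet[ℱ (n + 1)] (D ∩ B) := (ℱ.mono n.le_succ _ hD.1).inter hB.1
    have hD0 : P D ≠ 0 := fun h => hDB (measure_mono_null Set.inter_subset_left h)
    have hPB : P (D ∩ B) = P B := (hB.2 _ Set.inter_subset_right hm).resolve_right hDB
    have hae : (D ∩ B : Set Ω) =ᵐ[P] B := ae_eq_of_subset_of_measure_ge Set.inter_subset_right
      hPB.ge (ℱ.le _ _ hm).nullMeasurableSet (measure_ne_top _ _)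
    have h1 := h.norm_average_sub_le hR hα hf hD (hL n D hD hD0) hL0 hm Set.inter_subset_left hDB
    rw [setAverage_congr hae, measureReal_congr hae] at h1
    have h2 := ih hD hD0
    have h3 := norm_le_norm_add_norm_sub' (⨍ x in B, f x ∂P) (⨍ x in D, f x ∂P)
    linarith

theorem IsRegularWith.ae_norm_le [SecondCountableTopology E] [MeasurableSpace E] [BorelSpace E]
    (h : IsRegularWith ℱ P R) (hR : 2 ≤ R) (hα : 0 < α)
    (hm : ⨆ n, ℱ n = m) (h0 : ℱ 0 = ⊥) (hat : ∀ n, CountablyAtomic P (ℱ n))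
    (hfm : Measurable f) (hf : Integrable f P) (hL0 : 0 ≤ L)
    (hL : ∀ n B, IsAtom P (ℱ n) B → P B ≠ 0 →
      ∫ ω in B, ‖f ω - ⨍ x in B, f x ∂P‖ ∂P ≤ L * P.real B ^ α * P.real B) :
    ∀ᵐ ω ∂P, ‖f ω‖ ≤ ‖∫ x, f x ∂P‖ + (chainConst R α + 1) * L := by
  have hK := chainConst_pos hR hα
  have hn : ∀ᵐ ω ∂P, ∀ n, (P[fun x => ‖f x‖ | ℱ n]) ω ≤
      ‖∫ x, f x ∂P‖ + (chainConst R α + 1) * L := by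
    rw [ae_all_iff]
    intro n
    refine (hat n).ae_of_forall_atom fun B hB hB0 => ?_
    filter_upwards [hB.condExp_ae_eq_average (ℱ.le n) hB0 hf.norm] with ω hω
    have hBpos : 0 < P.real B := ENNReal.toReal_pos hB0 (measure_ne_top _ _)
    have hp1 : P.real B ^ α ≤ 1 := Real.rpow_le_one hBpos.le measureReal_le_one hα.le
    have hp0 : 0 ≤ P.real B ^ α := by positivity
    have h1 := h.norm_average_le hR hα h0 hat hf hL0 hL n hB hB0
    -- Passing from the average of `f` to that of `‖f‖` costs one more mean oscillation, the source
    -- of the `+ 1` in the constant.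
    have h2 : ⨍ x in B, ‖f x‖ ∂P ≤ ‖⨍ x in B, f x ∂P‖ + L * P.real B ^ α := by
      set c := ⨍ x in B, f x ∂P
      have hs : Integrable (fun x => ‖f x - c‖) (P.restrict B) :=
        (hf.sub (integrable_const _)).norm.integrableOn
      have h3 : ∫ x in B, ‖f x‖ ∂P ≤ P.real B * ‖c‖ + L * P.real B ^ α * P.real B := by
        calc ∫ x in B, ‖f x‖ ∂P ≤ ∫ x in B, (‖c‖ + ‖f x - c‖) ∂P :=
              integral_mono hf.norm.integrableOn ((integrable_const _).add hs)
                fun x => norm_le_norm_add_norm_sub' _ _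
          _ = P.real B * ‖c‖ + ∫ x in B, ‖f x - c‖ ∂P := by
              rw [integral_add (integrable_const _) hs, setIntegral_const, smul_eq_mul]
          _ ≤ _ := by gcongr; exact hL n B hB hB0
      rw [setAverage_eq, smul_eq_mul, inv_mul_le_iff₀ hBpos]
      linarith
    rw [hω]
    have h4 : chainConst R α * L * (1 - P.real B ^ α) ≤ chainConst R α * L * 1 := by
      gcongr; linarith
    have h5 : L * P.real B ^ α ≤ L * 1 := by gcongr
    linarith
  -- Lévy's upward theorem: since the `ℱ n` generate `m`, the bounded conditional expectations
  -- converge almost surely to `‖f‖`.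
  have hlim := hf.norm.tendsto_ae_condExp (ℱ := ℱ)
    (by rw [hm]; exact hfm.norm.stronglyMeasurable)
  filter_upwards [hn, hlim] with ω h1 h2
  exact le_of_tendsto' h2 h1

end Bounded

/-! ### Seminorm estimates for products -/

section Norms

variable {Ω : Type*} {m : MeasurableSpace Ω} {P : Measure Ω}
  {ℱ : Filtration ℕ m} {R α : ℝ} {𝕜 : Type*} [RCLike 𝕜] {f g : Ω → 𝕜}

theorem lipNorm_eq : lipNorm ℱ P α f = lipSeminorm ℱ P α f + ‖∫ ω, f ω ∂P‖ₑ := rfl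

theorem lipSeminorm_le_lipNorm : lipSeminorm ℱ P α f ≤ lipNorm ℱ P α f := le_self_add

theorem LipNat_eq_Lip : LipNat 𝕜 ℱ P α = Lip 𝕜 ℱ P α := by
  ext f
  simp [LipNat, Lip, lipNorm_eq, ENNReal.add_lt_top]

variable [IsProbabilityMeasure P]

/-- Conditional expectations are averages on atoms, so the seminorm reduces to division-free
inequalities between integrals. -/
theorem lipSeminorm_le_iff (hα : 0 < α) (hf : Integrable f P) {X : ℝ≥0∞} :
    lipSeminorm ℱ P α f ≤ X ↔ ∀ n B, IsAtom P (ℱ n) B → P B ≠ 0 →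
      ∫⁻ ω in B, ‖f ω - ⨍ x in B, f x ∂P‖ₑ ∂P ≤ X * P B ^ α * P B := by
  simp only [lipSeminorm, campanatoSeminorm, iSup_le_iff]
  refine forall_congr' fun n => forall_congr' fun B => forall_congr' fun hB =>
    forall_congr' fun hB0 => ?_
  have h1 : ∫⁻ ω in B, ‖f ω - (P[f | ℱ n]) ω‖ₑ ^ (1 : ℝ) ∂P =
      ∫⁻ ω in B, ‖f ω - ⨍ x in B, f x ∂P‖ₑ ∂P := by
    refine lintegral_congr_ae ?_
    filter_upwards [hB.condExp_ae_eq_average (ℱ.le n) hB0 hf] with ω hω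
    rw [hω, ENNReal.rpow_one]
  have h2 : ENNReal.ofReal (P.real B ^ α) = P B ^ α := by
    rw [← ENNReal.ofReal_rpow_of_nonneg measureReal_nonneg hα.le, ofReal_measureReal]
  have h3 : P B ^ α ≠ 0 := by simp [hB0, hα.not_gt]
  have h4 : P B ^ α ≠ ∞ := ENNReal.rpow_ne_top_of_nonneg hα.le (measure_ne_top _ _)
  rw [setLAverage_eq, h1, h2, div_one, ENNReal.rpow_one,
    ENNReal.div_le_iff h3 h4, ENNReal.div_le_iff hB0 (measure_ne_top _ _)]

theorem lintegral_le_lipSeminorm (hα : 0 < α) (hf : Integrable f P) {n : ℕ} {B : Set Ω}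
    (hB : IsAtom P (ℱ n) B) (hB0 : P B ≠ 0) :
    ∫⁻ ω in B, ‖f ω - ⨍ x in B, f x ∂P‖ₑ ∂P ≤ lipSeminorm ℱ P α f * P B ^ α * P B :=
  (lipSeminorm_le_iff hα hf).mp le_rfl n B hB hB0

theorem lipNorm_one (hα : 0 < α) : lipNorm ℱ P α (1 : Ω → 𝕜) = 1 := by
  have h : lipSeminorm ℱ P α (1 : Ω → 𝕜) ≤ 0 := by
    have hi : Integrable (1 : Ω → 𝕜) P := integrable_const (1 : 𝕜)
    rw [lipSeminorm_le_iff hα hi]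
    intro n B _ hB0
    simp only [Pi.one_apply, setAverage_const hB0 (measure_ne_top _ _)]
    simp
  rw [lipNorm_eq, nonpos_iff_eq_zero.mp h]
  simp

/-- The mean oscillation over a set is at most twice the mean distance to a constant. -/
theorem lintegral_sub_average_le {B : Set Ω} (hB0 : P B ≠ 0) (hf : Integrable f P) (c : 𝕜) :
    ∫⁻ ω in B, ‖f ω - ⨍ x in B, f x ∂P‖ₑ ∂P ≤ 2 * ∫⁻ ω in B, ‖f ω - c‖ₑ ∂P := by
  have hB : P.real B ≠ 0 := (ENNReal.toReal_pos hB0 (measure_ne_top _ _)).ne'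
  have h1 : ‖⨍ x in B, f x ∂P - c‖ₑ * P B ≤ ∫⁻ ω in B, ‖f ω - c‖ₑ ∂P := by
    rw [setAverage_sub_const hB0 hf, enorm_smul, enorm_inv hB,
      Real.enorm_of_nonneg measureReal_nonneg, ofReal_measureReal, mul_right_comm,
      ENNReal.inv_mul_cancel hB0 (measure_ne_top _ _), one_mul]
    exact enorm_integral_le_lintegral_enorm _
  calc ∫⁻ ω in B, ‖f ω - ⨍ x in B, f x ∂P‖ₑ ∂P
      ≤ ∫⁻ ω in B, (‖f ω - c‖ₑ + ‖⨍ x in B, f x ∂P - c‖ₑ) ∂P := by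
        refine lintegral_mono fun ω => ?_
        rw [← sub_sub_sub_cancel_right (f ω) _ c]
        exact enorm_sub_le
    _ = ∫⁻ ω in B, ‖f ω - c‖ₑ ∂P + ‖⨍ x in B, f x ∂P - c‖ₑ * P B := by
        rw [lintegral_add_right _ measurable_const, setLIntegral_const]
    _ ≤ 2 * ∫⁻ ω in B, ‖f ω - c‖ₑ ∂P := by rw [two_mul]; gcongr

theorem enorm_setAverage_le {B : Set Ω} (hB0 : P B ≠ 0) :
    ‖⨍ x in B, f x ∂P‖ₑ ≤ eLpNorm f ∞ P := by
  have hB : (P B)⁻¹ * P B = 1 := ENNReal.inv_mul_cancel hB0 (measure_ne_top _ _)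
  have hB' : P.real B ≠ 0 := (ENNReal.toReal_pos hB0 (measure_ne_top _ _)).ne'
  rw [setAverage_eq, enorm_smul, enorm_inv hB',
    Real.enorm_of_nonneg measureReal_nonneg, ofReal_measureReal, eLpNorm_exponent_top]
  calc (P B)⁻¹ * ‖∫ x in B, f x ∂P‖ₑ
      ≤ (P B)⁻¹ * ∫⁻ x in B, ‖f x‖ₑ ∂P := by gcongr; exact enorm_integral_le_lintegral_enorm _
    _ ≤ (P B)⁻¹ * ∫⁻ _ in B, eLpNormEssSup f P ∂P := by
        gcongr (P B)⁻¹ * ?_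
        exact lintegral_mono_ae (ae_restrict_of_ae (ae_le_eLpNormEssSup (f := f)))
    _ = eLpNormEssSup f P := by
        rw [setLIntegral_const, mul_left_comm, hB, mul_one]

/-- With `a`, `b` the averages of `f`, `g` over an atom, `f g - a b = f (g - b) + b (f - a)`. The
factor `2` pays for using `a b` in place of the average of `f g`. -/
theorem lipSeminorm_mul_le (hα : 0 < α) (hfm : Measurable f) (hgm : Measurable g)
    (hf : Integrable f P) (hg : Integrable g P) (hfg : Integrable (f * g) P) :
    lipSeminorm ℱ P α (f * g) ≤ 2 * (eLpNorm f ∞ P * lipSeminorm ℱ P α g +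
      eLpNorm g ∞ P * lipSeminorm ℱ P α f) := by
  rw [lipSeminorm_le_iff hα hfg]
  intro n B hB hB0
  set a := ⨍ x in B, f x ∂P with ha
  set b := ⨍ x in B, g x ∂P with hb
  have hF : ∀ᵐ x ∂P, ‖f x‖ₑ ≤ eLpNorm f ∞ P := by
    rw [eLpNorm_exponent_top]; exact ae_le_eLpNormEssSup
  calc _ ≤ 2 * ∫⁻ ω in B, ‖(f * g) ω - a * b‖ₑ ∂P := lintegral_sub_average_le hB0 hfg _
    _ ≤ 2 * ∫⁻ ω in B, (eLpNorm f ∞ P * ‖g ω - b‖ₑ + eLpNorm g ∞ P * ‖f ω - a‖ₑ) ∂P := by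
        refine mul_le_mul_right (lintegral_mono_ae (ae_restrict_of_ae ?_)) 2
        filter_upwards [hF] with ω hω
        have : (f * g) ω - a * b = f ω * (g ω - b) + b * (f ω - a) := by
          simp only [Pi.mul_apply]; ring
        rw [this]
        refine (enorm_add_le _ _).trans ?_
        rw [enorm_mul, enorm_mul]
        gcongr
        exact enorm_setAverage_le hB0
    _ = 2 * (eLpNorm f ∞ P * ∫⁻ ω in B, ‖g ω - b‖ₑ ∂P +
          eLpNorm g ∞ P * ∫⁻ ω in B, ‖f ω - a‖ₑ ∂P) := by
        rw [lintegral_add_left (by fun_prop), lintegral_const_mul _ (by fun_prop),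
          lintegral_const_mul _ (by fun_prop)]
    _ ≤ 2 * (eLpNorm f ∞ P * (lipSeminorm ℱ P α g * P B ^ α * P B) +
          eLpNorm g ∞ P * (lipSeminorm ℱ P α f * P B ^ α * P B)) := by
        gcongr
        · exact lintegral_le_lipSeminorm hα hg hB hB0
        · exact lintegral_le_lipSeminorm hα hf hB hB0
    _ = _ := by ring

theorem enorm_integral_le_eLpNorm_top : ‖∫ x, f x ∂P‖ₑ ≤ eLpNorm f ∞ P := by
  have h := enorm_setAverage_le (P := P) (f := f) (B := Set.univ) (by simp)
  rwa [Measure.restrict_univ, average_eq_integral] at h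

theorem lipNorm_mul_le (hα : 0 < α) (hfm : Measurable f) (hgm : Measurable g)
    (hf : Integrable f P) (hg : Integrable g P) (hfg : Integrable (f * g) P) :
    lipNorm ℱ P α (f * g) ≤ 2 * (eLpNorm f ∞ P * lipSeminorm ℱ P α g +
      eLpNorm g ∞ P * lipSeminorm ℱ P α f) + eLpNorm f ∞ P * eLpNorm g ∞ P := by
  rw [lipNorm_eq]
  gcongr
  · exact lipSeminorm_mul_le hα hfm hgm hf hg hfg
  · refine enorm_integral_le_eLpNorm_top.trans ?_
    simpa [Pi.mul_def] using eLpNorm_le_eLpNorm_top_mul_eLpNorm ∞ f hgm.aestronglyMeasurable (· * ·) 1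
      (ae_of_all P fun x => by simp)

/-- For `α > 0`, the functions of `Lip♮_α` on a regular filtration are essentially bounded. -/
theorem IsRegularWith.eLpNorm_top_le (h : IsRegularWith ℱ P R) (hR : 2 ≤ R) (hα : 0 < α)
    (hm : ⨆ n, ℱ n = m) (h0 : ℱ 0 = ⊥) (hat : ∀ n, CountablyAtomic P (ℱ n))
    (hf : f ∈ LipNat 𝕜 ℱ P α) :
    eLpNorm f ∞ P ≤ ENNReal.ofReal (chainConst R α + 1) * lipNorm ℱ P α f := by
  obtain ⟨⟨hfm, hfi⟩, hfin⟩ := hf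
  have hLfin : lipSeminorm ℱ P α f ≠ ∞ := (lipSeminorm_le_lipNorm.trans_lt hfin).ne
  have hK := chainConst_pos hR hα
  have hL : ∀ n B, IsAtom P (ℱ n) B → P B ≠ 0 → ∫ ω in B, ‖f ω - ⨍ x in B, f x ∂P‖ ∂P ≤
      (lipSeminorm ℱ P α f).toReal * P.real B ^ α * P.real B := by
    intro n B hB hB0
    have h1 := lintegral_le_lipSeminorm hα hfi hB hB0
    rw [integral_norm_eq_lintegral_enorm (by fun_prop), Measure.real, ENNReal.toReal_rpow,
      ← ENNReal.toReal_mul, ← ENNReal.toReal_mul]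
    refine ENNReal.toReal_mono ?_ h1
    exact ENNReal.mul_ne_top (ENNReal.mul_ne_top hLfin
      (ENNReal.rpow_ne_top_of_nonneg hα.le (measure_ne_top _ _))) (measure_ne_top _ _)
  have h1 := h.ae_norm_le hR hα hm h0 hat hfm hfi ENNReal.toReal_nonneg hL
  rw [eLpNorm_exponent_top]
  refine (eLpNormEssSup_le_of_ae_bound h1).trans ?_
  rw [lipNorm_eq, ENNReal.ofReal_add (by positivity) (by positivity),
    ENNReal.ofReal_mul (by positivity), ENNReal.ofReal_toReal hLfin, ofReal_norm, mul_add, add_comm]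
  gcongr
  exact le_mul_of_one_le_left zero_le (by simp [hK.le])

end Norms

end MartingaleCampanato

/-! ### Characterization of the multipliers -/

open MartingaleCampanato in
theorem corollary1p3 {𝕜 : Type*} [RCLike 𝕜] (α R : ℝ) (hα : 0 < α) (hR : 2 ≤ R) :
    ∃ C : ℝ≥0, 0 < C ∧
      ∀ {Ω : Type*} {m : MeasurableSpace Ω} (P : Measure Ω) [IsProbabilityMeasure P]
        (ℱ : Filtration ℕ m),
        (⨆ n, ℱ n) = m →
        (∀ n, MartingaleCampanato.CountablyAtomic P (ℱ n)) →
        ℱ 0 = ⊥ →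
        MartingaleCampanato.IsRegularWith ℱ P R →
        MartingaleCampanato.PWM (MartingaleCampanato.LipNat 𝕜 ℱ P α) =
            MartingaleCampanato.Lip 𝕜 ℱ P α ∩ MartingaleCampanato.Linfty 𝕜 P ∧
        ∀ g ∈ MartingaleCampanato.PWM (MartingaleCampanato.LipNat 𝕜 ℱ P α),
          MartingaleCampanato.opNorm P (MartingaleCampanato.LipNat 𝕜 ℱ P α)
              (MartingaleCampanato.lipNorm ℱ P α) g ≤
            C * (MartingaleCampanato.lipSeminorm ℱ P α g + eLpNorm g ∞ P) ∧
          MartingaleCampanato.lipSeminorm ℱ P α g + eLpNorm g ∞ P ≤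
            C * MartingaleCampanato.opNorm P (MartingaleCampanato.LipNat 𝕜 ℱ P α)
              (MartingaleCampanato.lipNorm ℱ P α) g := by
  set K : ℝ≥0 := (chainConst R α + 1).toNNReal
  -- The product estimate gives coefficients `2 K` and `K + 2`, and testing on `1` gives `K + 1`; `3
  -- K + 2` dominates all three.
  refine ⟨3 * K + 2, by positivity, fun {Ω m} P _ ℱ hm hat h0 hreg => ?_⟩
  have hbd : ∀ f ∈ LipNat 𝕜 ℱ P α, eLpNorm f ∞ P ≤ K * lipNorm ℱ P α f :=
    fun f hf => hreg.eLpNorm_top_le hR hα hm h0 hat hf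
  have hone : (1 : Ω → 𝕜) ∈ LipNat 𝕜 ℱ P α :=
    ⟨⟨measurable_one, integrable_const (1 : 𝕜)⟩, by rw [lipNorm_one hα]; exact ENNReal.one_lt_top⟩
  have hmem : ∀ g ∈ PWM (LipNat 𝕜 ℱ P α), g ∈ LipNat 𝕜 ℱ P α := fun g hg => by
    simpa using hg.2 1 hone
  have hbdd : ∀ f ∈ LipNat 𝕜 ℱ P α, MemLp f ∞ P := fun f hf =>
    ⟨hf.1.1.aestronglyMeasurable,
      (hbd f hf).trans_lt (ENNReal.mul_lt_top ENNReal.coe_lt_top hf.2)⟩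
  have hint : ∀ f ∈ LipNat 𝕜 ℱ P α, ∀ g ∈ Linfty 𝕜 P, Integrable (f * g) P :=
    fun f hf g hg => hf.1.2.mul_of_top_left hg.2
  have hmul : ∀ f ∈ LipNat 𝕜 ℱ P α, ∀ g ∈ Lip 𝕜 ℱ P α ∩ Linfty 𝕜 P, lipNorm ℱ P α (f * g) ≤
      (3 * K + 2 : ℝ≥0) * (lipSeminorm ℱ P α g + eLpNorm g ∞ P) * lipNorm ℱ P α f := by
    intro f hf g hg
    calc lipNorm ℱ P α (f * g)
        ≤ 2 * (eLpNorm f ∞ P * lipSeminorm ℱ P α g + eLpNorm g ∞ P * lipSeminorm ℱ P α f) +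
            eLpNorm f ∞ P * eLpNorm g ∞ P :=
          lipNorm_mul_le hα hf.1.1 hg.1.1.1 hf.1.2 hg.1.1.2 (hint f hf g hg.2)
      _ ≤ 2 * (K * lipNorm ℱ P α f * lipSeminorm ℱ P α g + eLpNorm g ∞ P * lipNorm ℱ P α f) +
            K * lipNorm ℱ P α f * eLpNorm g ∞ P := by
          gcongr
          · exact hbd f hf
          · exact lipSeminorm_le_lipNorm
          · exact hbd f hf
      -- The added terms raise both coefficients to exactly `3 K + 2`, so that the sum factors.
      _ ≤ 2 * (K * lipNorm ℱ P α f * lipSeminorm ℱ P α g + eLpNorm g ∞ P * lipNorm ℱ P α f) +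
            K * lipNorm ℱ P α f * eLpNorm g ∞ P +
            (K * lipNorm ℱ P α f * lipSeminorm ℱ P α g +
              2 * (lipNorm ℱ P α f * lipSeminorm ℱ P α g) +
              2 * (K * lipNorm ℱ P α f * eLpNorm g ∞ P)) := le_self_add
      _ = _ := by push_cast; ring
  have heq : PWM (LipNat 𝕜 ℱ P α) = Lip 𝕜 ℱ P α ∩ Linfty 𝕜 P := by
    refine Set.Subset.antisymm (fun g hg => ?_) fun g hg => ⟨hg.1.1.1, fun f hf => ?_⟩
    · exact ⟨LipNat_eq_Lip (𝕜 := 𝕜) (P := P) (ℱ := ℱ) (α := α) ▸ hmem g hg, hg.1, hbdd g (hmem g hg)⟩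
    · refine ⟨⟨hf.1.1.mul hg.1.1.1, hint f hf g hg.2⟩, (hmul f hf g hg).trans_lt ?_⟩
      exact ENNReal.mul_lt_top (ENNReal.mul_lt_top ENNReal.coe_lt_top
        (ENNReal.add_lt_top.mpr ⟨hg.1.2, hg.2.2.2⟩)) hf.2
  refine ⟨heq, fun g hg => ⟨?_, ?_⟩⟩
  · exact iSup₂_le fun f hf => iSup_le fun _ =>
      ENNReal.div_le_of_le_mul (hmul f hf g (heq ▸ hg))
  · have hne : ¬ (1 : Ω → 𝕜) =ᵐ[P] 0 := fun h => by
      obtain ⟨_, h⟩ := h.exists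
      exact one_ne_zero h
    have hop : lipNorm ℱ P α g ≤ opNorm P (LipNat 𝕜 ℱ P α) (lipNorm ℱ P α) g := by
      refine le_iSup₂_of_le (1 : Ω → 𝕜) hone (le_iSup_of_le hne ?_)
      rw [lipNorm_one (𝕜 := 𝕜) hα, one_mul, div_one]
    calc lipSeminorm ℱ P α g + eLpNorm g ∞ P
        ≤ lipNorm ℱ P α g + K * lipNorm ℱ P α g :=
          add_le_add lipSeminorm_le_lipNorm (hbd g (hmem g hg))
      _ ≤ lipNorm ℱ P α g + K * lipNorm ℱ P α g + (1 + 2 * K) * lipNorm ℱ P α g := le_self_add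
      _ = (3 * K + 2 : ℝ≥0) * lipNorm ℱ P α g := by push_cast; ring
      _ ≤ _ := by gcongr
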